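/- Let $n\ge k\ge 1$ be integers and let $\Pi_n^k$ be the set of partitions of $[n]=\{1,\dots,n\}$ into $k$ blocks. The linear representation of $\pi\in\Pi_n^k$ consists of the arcs $\{i,j\}$, $i<j$, where $i,j$ are consecutive elements of a block of $\pi$ (in increasing order). The circular representation of $\pi$ (with $1,\dots,n$ placed in order on a circle) consists of these same pairs $\{i,j\}$, drawn as chords, together with the chord $\{\min B,\max B\}$ for each block $B$ with at least two elements (so a block of two elements gives a single chord). Two arcs or chords $\{i,j\}$, $\{i',j'\}$ with $i<j$, $i'<j'$ cross if $i<i'<j<j'$ or $i'<i<j'<j$. Let $\mathrm{cr}^{(\ell)}(\pi)$ and $\mathrm{cr}^{(c)}(\pi)$ be the numbers of unordered pairs of crossing arcs, respectively crossing chords, of $\pi$, and let $M^{(\ell)}_{n,k}$ and $M^{(c)}_{n,k}$ be the maxima of $\mathrm{cr}^{(\ell)}$ and $\mathrm{cr}^{(c)}$ over $\Pi_n^k$. Then: (1a) if $1\le k\le\lfloor n/2\rfloor$, then $M^{(\ell)}_{n,k}=(k-1)n-3\binom{k}{2}$; (1b) if $\lceil n/2\rceil\le k\le n$, then $M^{(\ell)}_{n,k}=\binom{n-k}{2}$;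 (2a) if $k\le n/3$, then $M^{(c)}_{n,k}=2\binom{k}{2}\lfloor n/k\rfloor+2\binom{r}{2}=(k-1)n-r(k-r)$, where $r$ is the remainder in the division of $n$ by $k$; (2b) if $n/3\le k<n/2$ or $n/2\le k\le n-6$, then, with $a=n-k$, $M^{(c)}_{n,k}=6\binom{\lfloor a/2\rfloor}{2}+2\lfloor a/2\rfloor\,\chi(a\text{ odd})$, where $\chi(a\text{ odd})$ is $1$ if $a$ is odd and $0$ otherwise; (2c) if $k\ge n-5$ and $k\ge n/2$, then $M^{(c)}_{n,k}=\binom{n-k}{2}$. -/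

import Mathlib

namespace SetPartition

/-- The set partitions of `[n] = {1, 2, …, n}`. -/
abbrev Partitions (n : ℕ) : Type := Finpartition (Finset.Icc 1 n)

/-- The arcs joining consecutive elements of the block `B`, as pairs (left end, right end). -/
def blockArcs (B : Finset ℕ) : Finset (ℕ × ℕ) :=
  (B ×ˢ B).filter fun e => e.1 < e.2 ∧ ∀ x ∈ B, x ≤ e.1 ∨ e.2 ≤ x

/-- The sides of the simple polygon with vertex set `B` on a circle, as pairs
(smaller end, larger end): the pairs of consecutive elements, and the pair formed by the minimum
and the maximum. A block of size two gives one chord, a block of size one gives none. -/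
def blockChords (B : Finset ℕ) : Finset (ℕ × ℕ) :=
  (B ×ˢ B).filter fun e => e.1 < e.2 ∧
    ((∀ x ∈ B, x ≤ e.1 ∨ e.2 ≤ x) ∨ (∀ x ∈ B, e.1 ≤ x ∧ x ≤ e.2))

/-- The arcs of the linear representation of a set partition. -/
def arcs {n : ℕ} (π : Partitions n) : Finset (ℕ × ℕ) := π.parts.biUnion blockArcs

/-- The chords of the circular representation of a set partition. -/
def chords {n : ℕ} (π : Partitions n) : Finset (ℕ × ℕ) := π.parts.biUnion blockChords

/-- The number of crossing pairs `(i, j)`, `(i', j')` in `S`, where `i < i' < j < j'`. The pair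
whose left end is smaller is listed first, so every unordered pair is counted once. -/
def crossings (S : Finset (ℕ × ℕ)) : ℕ :=
  ((S ×ˢ S).filter fun p => p.1.1 < p.2.1 ∧ p.2.1 < p.1.2 ∧ p.1.2 < p.2.2).card

/-- The number of arc crossings in the linear representation. -/
def crLinear {n : ℕ} (π : Partitions n) : ℕ := crossings (arcs π)

/-- The number of chord crossings in the circular representation. -/
def crCircular {n : ℕ} (π : Partitions n) : ℕ := crossings (chords π)

/-- `M` is the maximum of `f` over the partitions of `[n]` into `k` blocks. -/
def IsMaxOver (n k : ℕ) (f : Partitions n → ℕ) (M : ℕ) : Prop :=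
  IsGreatest (f '' {π : Partitions n | π.parts.card = k}) M

end SetPartition

/-! Upper bounds. A block does not cross itself, so crossings split over pairs of blocks, and a
bound for each pair, summed over all pairs, becomes a quadratic form in a few block statistics. Put
`a = n - k`.

Linear case: two blocks of size at least two have at most `|A| + |B| - 3` crossings. With `m` blocks
of size at least two this gives `2 cr ≤ 2(m-1)a - m(m-1)`, which does not decrease in `m` up to `m =
a`; since `m ≤ min(k, a)`, the two regimes are `m = k` and `m = a`.

Circular case: a chord meets the polygon of a disjoint block in at most two sides, so a pair of
blocks has at most `2 min(|A|, |B|)` crossings. If `g_l` blocks have more than `l` elements, then `∑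
g_l = n` and the bound for `cr` is `∑ g_l² - n`; it is controlled by `∑ g_l (k - g_l) ≥ r(k - r)`.
This is sharp for `3k ≤ n`. For larger `k` the sharper counts for two-element blocks (one chord, not
two) and singletons (none) matter: with `q` blocks of size at least three, `2 cr ≤ a(a-1) +
2q(q-2)`. As `0 ≤ q ≤ a/2` and `q(q-2)` is convex, the best `q` is `⌊a/2⌋` or `0`: the former if `q
≥ 1` is forced (`2k < n`) or `a ≥ 6`, while `a ≤ 5` forces `q(q-2) ≤ 0`.

Lower bounds. All extremal partitions have one shape: residue classes modulo `m` on `[N]`,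
singletons beyond, with `N = n - k + m` so that there are `k` blocks. Arcs and closing chords are
then families `(i, i + d)` of constant length, whose crossings are arithmetic sums. -/

namespace SetPartition

/-! ### Reduction to pairs of blocks -/

/-- The number of pairs `(e, f)` in `S × T` that cross, with the left end of `e` smaller. -/
def crossCount (S T : Finset (ℕ × ℕ)) : ℕ :=
  ((S ×ˢ T).filter fun p => p.1.1 < p.2.1 ∧ p.2.1 < p.1.2 ∧ p.1.2 < p.2.2).card

theorem crossings_biUnion_le (P : Finset (Finset ℕ)) (g : Finset ℕ → Finset (ℕ × ℕ)) :
    crossings (P.biUnion g) ≤ ∑ A ∈ P, ∑ B ∈ P, crossCount (g A) (g B) := by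
  have h : (((P.biUnion g) ×ˢ (P.biUnion g)).filter fun p =>
      p.1.1 < p.2.1 ∧ p.2.1 < p.1.2 ∧ p.1.2 < p.2.2) ⊆
      P.biUnion fun A => P.biUnion fun B => ((g A ×ˢ g B).filter fun p =>
      p.1.1 < p.2.1 ∧ p.2.1 < p.1.2 ∧ p.1.2 < p.2.2) := by
    intro p hp
    simp only [Finset.mem_filter, Finset.mem_product, Finset.mem_biUnion] at hp ⊢
    obtain ⟨⟨⟨A, hA, h1⟩, ⟨B, hB, h2⟩⟩, h3⟩ := hp
    exact ⟨A, hA, B, hB, ⟨h1, h2⟩, h3⟩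
  refine (Finset.card_le_card h).trans (Finset.card_biUnion_le.trans ?_)
  exact Finset.sum_le_sum fun A _ => Finset.card_biUnion_le

/-- The diagonal of `w` is added and subtracted so that the double sum runs over all of `P × P`; for
`w` built from products `f A * g B` it then factors into products of single sums. -/
theorem two_mul_crossings_biUnion_le (P : Finset (Finset ℕ)) (g : Finset ℕ → Finset (ℕ × ℕ))
    (w : Finset ℕ → Finset ℕ → ℤ) (h0 : ∀ A ∈ P, crossCount (g A) (g A) = 0)
    (h : ∀ A ∈ P, ∀ B ∈ P, A ≠ B → ((crossCount (g A) (g B) + crossCount (g B) (g A) : ℕ) : ℤ)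
      ≤ w A B) :
    2 * (crossings (P.biUnion g) : ℤ) ≤ ∑ A ∈ P, ∑ B ∈ P, w A B - ∑ A ∈ P, w A A := by
  have h1 : (crossings (P.biUnion g) : ℤ) ≤
      ∑ A ∈ P, ∑ B ∈ P, (crossCount (g A) (g B) : ℤ) := by
    exact_mod_cast crossings_biUnion_le P g
  have h2 : ∑ A ∈ P, ∑ B ∈ P, (crossCount (g A) (g B) : ℤ) =
      ∑ A ∈ P, ∑ B ∈ P, (crossCount (g B) (g A) : ℤ) := Finset.sum_comm
  have h3 : 2 * (crossings (P.biUnion g) : ℤ) ≤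
      ∑ A ∈ P, ∑ B ∈ P, ((crossCount (g A) (g B) : ℤ) + crossCount (g B) (g A)) := by
    simp only [Finset.sum_add_distrib]
    linarith
  refine h3.trans ?_
  rw [← Finset.sum_sub_distrib]
  refine Finset.sum_le_sum fun A hA => ?_
  rw [← Finset.add_sum_erase _ _ hA, ← Finset.add_sum_erase _ (fun B => w A B) hA]
  have : ∑ B ∈ P.erase A, ((crossCount (g A) (g B) : ℤ) + crossCount (g B) (g A)) ≤
      ∑ B ∈ P.erase A, w A B := by
    refine Finset.sum_le_sum fun B hB => ?_
    have := h A hA B (Finset.mem_of_mem_erase hB) (Finset.ne_of_mem_erase hB).symm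
    push_cast at this
    exact this
  rw [h0 A hA]
  push_cast
  linarith

/-! ### Crossings between two blocks -/

theorem mem_blockArcs {B : Finset ℕ} {e : ℕ × ℕ} : e ∈ blockArcs B ↔
    (e.1 ∈ B ∧ e.2 ∈ B) ∧ e.1 < e.2 ∧ ∀ x ∈ B, x ≤ e.1 ∨ e.2 ≤ x := by
  simp [blockArcs]

theorem mem_blockChords {B : Finset ℕ} {e : ℕ × ℕ} : e ∈ blockChords B ↔
    (e.1 ∈ B ∧ e.2 ∈ B) ∧ e.1 < e.2 ∧
      ((∀ x ∈ B, x ≤ e.1 ∨ e.2 ≤ x) ∨ (∀ x ∈ B, e.1 ≤ x ∧ x ≤ e.2)) := by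
  simp [blockChords]

theorem blockArcs_subset_blockChords (B : Finset ℕ) : blockArcs B ⊆ blockChords B := by
  intro e he
  rw [mem_blockArcs] at he
  exact mem_blockChords.2 ⟨he.1, he.2.1, Or.inl he.2.2⟩

theorem crossCount_mono {S S' T T' : Finset (ℕ × ℕ)} (hS : S ⊆ S') (hT : T ⊆ T') :
    crossCount S T ≤ crossCount S' T' :=
  Finset.card_le_card (Finset.filter_subset_filter _ (Finset.product_subset_product hS hT))

theorem crossCount_blockChords_self (B : Finset ℕ) :
    crossCount (blockChords B) (blockChords B) = 0 := by
  rw [crossCount, Finset.card_eq_zero, Finset.filter_eq_empty_iff]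
  rintro ⟨⟨a, b⟩, ⟨c, d⟩⟩ hp
  simp only [Finset.mem_product, mem_blockChords] at hp
  obtain ⟨⟨⟨ha, hb⟩, hab, h1⟩, ⟨hc, hd⟩, hcd, h2⟩ := hp
  rintro ⟨h3, h4, h5⟩
  simp only at *
  rcases h1 with h1 | h1
  · have := h1 c hc
    omega
  · have := h1 d hd
    omega

theorem crossCount_blockArcs_self (B : Finset ℕ) :
    crossCount (blockArcs B) (blockArcs B) = 0 :=
  Nat.le_zero.1 ((crossCount_mono (blockArcs_subset_blockChords B)
    (blockArcs_subset_blockChords B)).trans (crossCount_blockChords_self B).le)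

theorem blockChords_eq_empty {B : Finset ℕ} (hB : B.card ≤ 1) : blockChords B = ∅ := by
  rw [Finset.eq_empty_iff_forall_notMem]
  intro e he
  rw [mem_blockChords] at he
  have := Finset.card_le_one.1 hB _ he.1.1 _ he.1.2
  omega

theorem blockArcs_eq_empty {B : Finset ℕ} (hB : B.card ≤ 1) : blockArcs B = ∅ :=
  Finset.subset_empty.1 (blockChords_eq_empty hB ▸ blockArcs_subset_blockChords B)

@[simp] theorem crossCount_empty_left (T : Finset (ℕ × ℕ)) : crossCount ∅ T = 0 := by
  simp [crossCount]

@[simp] theorem crossCount_empty_right (T : Finset (ℕ × ℕ)) : crossCount T ∅ = 0 := by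
  simp [crossCount]

/-- A crossing is determined by the left end `c` of its second arc: `c` fixes that arc, and only one
arc of `A` passes over `c`. -/
theorem crossCount_blockArcs_le {A B : Finset ℕ} :
    crossCount (blockArcs A) (blockArcs B) ≤
      (B.filter fun x => (∃ z ∈ B, x < z) ∧ ∃ z ∈ A, z < x).card := by
  refine Finset.card_le_card_of_injOn (fun p => p.2.1) ?_ ?_
  · rintro ⟨⟨a, b⟩, ⟨c, d⟩⟩ hp
    simp only [Finset.coe_filter, Finset.mem_product, mem_blockArcs, Set.mem_ofPred_eq] at hp ⊢
    exact ⟨hp.1.2.1.1, ⟨d, hp.1.2.1.2, hp.1.2.2.1⟩, ⟨a, hp.1.1.1.1, hp.2.1⟩⟩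
  · rintro ⟨⟨a, b⟩, ⟨c, d⟩⟩ hp ⟨⟨a', b'⟩, ⟨c', d'⟩⟩ hq h
    simp only [Finset.coe_filter, Finset.mem_product, mem_blockArcs, Set.mem_ofPred_eq] at hp hq h
    obtain ⟨⟨⟨⟨ha, hb⟩, hab, h1⟩, ⟨hc, hd⟩, hcd, h2⟩, h3, h4, h5⟩ := hp
    obtain ⟨⟨⟨⟨ha', hb'⟩, hab', h1'⟩, ⟨hc', hd'⟩, hcd', h2'⟩, h3', h4', h5'⟩ := hq
    subst h
    have := h1 a' ha'
    have := h1 b' hb'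
    have := h1' a ha
    have := h1' b hb
    have := h2 d' hd'
    have := h2' d hd
    simp only [Prod.mk.injEq, true_and]
    omega

/-- Each block loses its maximum, which is no left end, and the block with the smaller minimum also
loses that minimum, below which the other block has nothing. -/
theorem crossCount_blockArcs_add_le {A B : Finset ℕ} (hAB : Disjoint A B) (hA : 2 ≤ A.card)
    (hB : 2 ≤ B.card) :
    crossCount (blockArcs A) (blockArcs B) + crossCount (blockArcs B) (blockArcs A) + 3 ≤
      A.card + B.card := by
  have hAn : A.Nonempty := Finset.card_pos.1 (by omega)
  have hBn : B.Nonempty := Finset.card_pos.1 (by omega)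
  have h1 := crossCount_blockArcs_le (A := A) (B := B)
  have h2 := crossCount_blockArcs_le (A := B) (B := A)
  have key : ∀ {A B : Finset ℕ} (hA : A.Nonempty) (hB : B.Nonempty), 2 ≤ B.card →
      (B.filter fun x => (∃ z ∈ B, x < z) ∧ ∃ z ∈ A, z < x).card + 1 +
        (if B.min' hB < A.min' hA then 1 else 0) ≤ B.card := by
    intro A B hA hB hB2
    have hlt : B.min' hB < B.max' hB := Finset.min'_lt_max'_of_card B (by omega)
    split_ifs with hmin
    · have hs : (B.filter fun x => (∃ z ∈ B, x < z) ∧ ∃ z ∈ A, z < x) ⊆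
          (B.erase (B.max' hB)).erase (B.min' hB) := by
        intro x hx
        simp only [Finset.mem_filter] at hx
        obtain ⟨hxB, ⟨z, hz, hxz⟩, ⟨y, hy, hyx⟩⟩ := hx
        have := B.le_max' z hz
        have := A.min'_le y hy
        simp only [Finset.mem_erase]
        exact ⟨by omega, by omega, hxB⟩
      have := Finset.card_le_card hs
      rw [Finset.card_erase_of_mem (Finset.mem_erase.2 ⟨by omega, B.min'_mem hB⟩),
        Finset.card_erase_of_mem (B.max'_mem hB)] at this
      omega
    · have hs : (B.filter fun x => (∃ z ∈ B, x < z) ∧ ∃ z ∈ A, z < x) ⊆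
          B.erase (B.max' hB) := by
        intro x hx
        simp only [Finset.mem_filter] at hx
        obtain ⟨hxB, ⟨z, hz, hxz⟩, -⟩ := hx
        have := B.le_max' z hz
        simp only [Finset.mem_erase]
        exact ⟨by omega, hxB⟩
      have := Finset.card_le_card hs
      rw [Finset.card_erase_of_mem (B.max'_mem hB)] at this
      omega
  have k1 := key hAn hBn hB
  have k2 := key hBn hAn hA
  have hne : A.min' hAn ≠ B.min' hBn := fun h =>
    Finset.disjoint_left.1 hAB (A.min'_mem hAn) (h ▸ B.min'_mem hBn)
  split_ifs at k1 k2 <;> omega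

/-- Consecutive pairs are sent to their left end; the remaining closing chord goes to the maximum,
which is never a left end. -/
theorem card_blockChords_le (B : Finset ℕ) : (blockChords B).card ≤ B.card := by
  classical
  refine Finset.card_le_card_of_injOn
    (fun e => if ∀ x ∈ B, x ≤ e.1 ∨ e.2 ≤ x then e.1 else e.2) ?_ ?_
  · intro e he
    rw [Finset.mem_coe, mem_blockChords] at he
    dsimp only
    split_ifs
    · exact he.1.1
    · exact he.1.2
  · rintro ⟨a, b⟩ he ⟨c, d⟩ hf h
    rw [Finset.mem_coe, mem_blockChords] at he hf
    simp only at he hf h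
    obtain ⟨⟨ha, hb⟩, hab, h1⟩ := he
    obtain ⟨⟨hc, hd⟩, hcd, h2⟩ := hf
    simp only [Prod.mk.injEq]
    split_ifs at h with h3 h4 h4
    · have := h3 d hd
      have := h4 b hb
      omega
    · have := (h2.resolve_left h4) b hb
      omega
    · have := (h1.resolve_left h3) d hd
      omega
    · have := (h2.resolve_left h4) a ha
      have := (h1.resolve_left h3) c hc
      omega

theorem card_blockChords_of_card_eq_two {B : Finset ℕ} (hB : B.card = 2) :
    (blockChords B).card ≤ 1 := by
  rw [Finset.card_le_one]
  rintro ⟨a, b⟩ he ⟨c, d⟩ hf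
  rw [mem_blockChords] at he hf
  obtain ⟨x, y, hxy, rfl⟩ := Finset.card_eq_two.1 hB
  simp only [Finset.mem_insert, Finset.mem_singleton] at he hf
  simp only [Prod.mk.injEq]
  omega

/-- The chords in `T` that cross the chord `e`. -/
def crossing (e : ℕ × ℕ) (T : Finset (ℕ × ℕ)) : Finset (ℕ × ℕ) :=
  T.filter fun f => (e.1 < f.1 ∧ f.1 < e.2 ∧ e.2 < f.2) ∨ (f.1 < e.1 ∧ e.1 < f.2 ∧ f.2 < e.2)

theorem crossCount_add_comm_eq_sum (S T : Finset (ℕ × ℕ)) :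
    crossCount S T + crossCount T S = ∑ e ∈ S, (crossing e T).card := by
  have h1 : crossCount S T =
      ∑ e ∈ S, (T.filter fun f => e.1 < f.1 ∧ f.1 < e.2 ∧ e.2 < f.2).card := by
    rw [crossCount, Finset.card_filter, Finset.sum_product]
    exact Finset.sum_congr rfl fun e _ => by rw [Finset.card_filter]
  have h2 : crossCount T S =
      ∑ e ∈ S, (T.filter fun f => f.1 < e.1 ∧ e.1 < f.2 ∧ f.2 < e.2).card := by
    rw [crossCount, Finset.card_filter, Finset.sum_product_right]
    exact Finset.sum_congr rfl fun e _ => by rw [Finset.card_filter]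
  rw [h1, h2, ← Finset.sum_add_distrib]
  refine Finset.sum_congr rfl fun e _ => ?_
  rw [crossing, Finset.filter_or, Finset.card_union_of_disjoint]
  rw [Finset.disjoint_filter]
  intro f _ h3 h4
  omega

/-- A line meets a convex polygon in at most two sides. The Boolean records whether a consecutive
side straddles `i` or `j`. A closing side that crosses on the `i` side leaves no point of `B` beyond
`j`, hence no side straddling `j`, and takes that free value; symmetrically for `j`. -/
theorem card_crossing_blockChords_le {B : Finset ℕ} {e : ℕ × ℕ} (h1 : e.1 ∉ B) (h2 : e.2 ∉ B) :
    (crossing e (blockChords B)).card ≤ 2 := by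
  classical
  obtain ⟨i, j⟩ := e
  have : (crossing (i, j) (blockChords B)).card ≤ (Finset.univ : Finset Bool).card := by
    refine Finset.card_le_card_of_injOn
      (fun f => if ∀ x ∈ B, x ≤ f.1 ∨ f.2 ≤ x then decide (f.1 < i) else decide (i < f.1))
      (fun _ _ => Finset.mem_coe.2 (Finset.mem_univ _)) ?_
    rintro ⟨a, b⟩ he ⟨c, d⟩ hf h
    simp only [crossing, Finset.coe_filter, Set.mem_ofPred_eq, mem_blockChords] at he hf h
    obtain ⟨⟨⟨ha, hb⟩, hab, h3⟩, h4⟩ := he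
    obtain ⟨⟨⟨hc, hd⟩, hcd, h5⟩, h6⟩ := hf
    have nea : a ≠ i := fun h => h1 (h ▸ ha)
    have neb : b ≠ i := fun h => h1 (h ▸ hb)
    have nec : c ≠ i := fun h => h1 (h ▸ hc)
    have ned : d ≠ i := fun h => h1 (h ▸ hd)
    have nea' : a ≠ j := fun h => h2 (h ▸ ha)
    have neb' : b ≠ j := fun h => h2 (h ▸ hb)
    have nec' : c ≠ j := fun h => h2 (h ▸ hc)
    have ned' : d ≠ j := fun h => h2 (h ▸ hd)
    simp only [Prod.mk.injEq]
    split_ifs at h with h7 h8 h8 <;> rw [decide_eq_decide] at h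
    · have := h7 c hc
      have := h7 d hd
      have := h8 a ha
      have := h8 b hb
      omega
    · have := (h5.resolve_left h8) a ha
      have := (h5.resolve_left h8) b hb
      omega
    · have := (h3.resolve_left h7) c hc
      have := (h3.resolve_left h7) d hd
      omega
    · have := (h5.resolve_left h8) a ha
      have := (h5.resolve_left h8) b hb
      have := (h3.resolve_left h7) c hc
      have := (h3.resolve_left h7) d hd
      omega
  simpa using this

theorem crossCount_blockChords_add_le {A B : Finset ℕ} (hAB : Disjoint A B) :
    crossCount (blockChords A) (blockChords B) + crossCount (blockChords B) (blockChords A) ≤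
      2 * (blockChords A).card := by
  rw [crossCount_add_comm_eq_sum, mul_comm, ← smul_eq_mul]
  refine Finset.sum_le_card_nsmul _ _ _ fun e he => ?_
  rw [mem_blockChords] at he
  exact card_crossing_blockChords_le (Finset.disjoint_left.1 hAB he.1.1)
    (Finset.disjoint_left.1 hAB he.1.2)

theorem crossCount_blockChords_add_le_mul {A B : Finset ℕ} :
    crossCount (blockChords A) (blockChords B) + crossCount (blockChords B) (blockChords A) ≤
      (blockChords A).card * (blockChords B).card := by
  rw [crossCount_add_comm_eq_sum, ← smul_eq_mul]
  exact Finset.sum_le_card_nsmul _ _ _ fun e he => Finset.card_filter_le _ _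

/-! ### Upper bounds -/

theorem two_mul_choose_two (k : ℕ) : 2 * (k.choose 2 : ℤ) = k * (k - 1) := by
  have h := Nat.cast_choose_two ℚ k
  have : (2 * (k.choose 2 : ℚ)) = k * (k - 1) := by rw [h]; ring
  exact_mod_cast this

theorem sum_card_parts {n : ℕ} (π : Partitions n) : ∑ A ∈ π.parts, (A.card : ℤ) = n := by
  have := π.sum_card_parts
  rw [Nat.card_Icc] at this
  exact_mod_cast this

theorem sum_card_sub_one_parts {n : ℕ} (π : Partitions n) :
    ∑ A ∈ π.parts, ((A.card : ℤ) - 1) = n - π.parts.card := by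
  rw [Finset.sum_sub_distrib, sum_card_parts]
  simp

theorem one_le_card_of_mem_parts {n : ℕ} (π : Partitions n) {A : Finset ℕ} (hA : A ∈ π.parts) :
    1 ≤ A.card :=
  Finset.card_pos.2 (π.nonempty_of_mem_parts hA)

theorem disjoint_of_mem_parts {n : ℕ} (π : Partitions n) {A B : Finset ℕ} (hA : A ∈ π.parts)
    (hB : B ∈ π.parts) (h : A ≠ B) : Disjoint A B :=
  π.disjoint hA hB h

theorem sum_sum_mul {P : Finset (Finset ℕ)} (f g : Finset ℕ → ℤ) :
    ∑ A ∈ P, ∑ B ∈ P, f A * g B = (∑ A ∈ P, f A) * ∑ A ∈ P, g A :=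
  (Finset.sum_mul_sum _ _ _ _).symm

/-- With `m` the number of blocks of size at least two. -/
theorem exists_two_mul_crLinear_le {n : ℕ} (π : Partitions n) :
    ∃ m : ℤ, 0 ≤ m ∧ m ≤ π.parts.card ∧ m ≤ n - π.parts.card ∧
      2 * (crLinear π : ℤ) ≤ 2 * (m - 1) * (n - π.parts.card) - m * (m - 1) := by
  set x : Finset ℕ → ℤ := fun A => if 2 ≤ A.card then 1 else 0 with hx
  set e : Finset ℕ → ℤ := fun A => (A.card : ℤ) - 1 with he
  have he' : ∑ A ∈ π.parts, e A = n - π.parts.card := sum_card_sub_one_parts π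
  refine ⟨∑ A ∈ π.parts, x A, Finset.sum_nonneg fun A _ => ?_, ?_, ?_, ?_⟩
  · simp only [hx]; split_ifs <;> simp
  · rw [Finset.card_eq_sum_ones]
    push_cast
    refine Finset.sum_le_sum fun A _ => ?_
    simp only [hx]; split_ifs <;> simp
  · rw [← he']
    refine Finset.sum_le_sum fun A hA => ?_
    have := one_le_card_of_mem_parts π hA
    simp only [hx, he]; split_ifs <;> omega
  -- The weight is `|A| + |B| - 3` when both blocks have size at least two, and `0` otherwise.
  · have h := two_mul_crossings_biUnion_le π.parts blockArcs
      (fun A B => e A * x B + x A * e B - x A * x B)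
      (fun A _ => crossCount_blockArcs_self A) (fun A hA B hB hAB => ?_)
    · have hd : ∑ A ∈ π.parts, (e A * x A + x A * e A - x A * x A) =
          2 * ∑ A ∈ π.parts, e A - ∑ A ∈ π.parts, x A := by
        rw [Finset.mul_sum, ← Finset.sum_sub_distrib]
        refine Finset.sum_congr rfl fun A hA => ?_
        have := one_le_card_of_mem_parts π hA
        simp only [hx, he]; split_ifs <;> simp <;> omega
      simp only [Finset.sum_add_distrib, Finset.sum_sub_distrib, sum_sum_mul] at h hd
      rw [hd, he'] at h
      refine h.trans (le_of_eq ?_)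
      ring
    · have h1 := one_le_card_of_mem_parts π hA
      have h2 := one_le_card_of_mem_parts π hB
      by_cases hA2 : 2 ≤ A.card
      · by_cases hB2 : 2 ≤ B.card
        · have := crossCount_blockArcs_add_le (disjoint_of_mem_parts π hA hB hAB) hA2 hB2
          simp only [hx, he, hA2, hB2, if_true]
          push_cast
          omega
        · rw [blockArcs_eq_empty (B := B) (by omega)]
          have : (B.card : ℤ) = 1 := by omega
          simp [hx, he, hB2, this]
      · rw [blockArcs_eq_empty (B := A) (by omega)]
        have : (A.card : ℤ) = 1 := by omega
        simp [hx, he, hA2, this]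

theorem crLinear_le_of_le {n : ℕ} (π : Partitions n) (h : 2 * π.parts.card ≤ n) :
    (crLinear π : ℤ) ≤ ((π.parts.card : ℤ) - 1) * n - 3 * (π.parts.card.choose 2 : ℤ) := by
  obtain ⟨m, hm0, hmk, hma, hm⟩ := exists_two_mul_crLinear_le π
  have hc := two_mul_choose_two π.parts.card
  generalize π.parts.card = k at *
  have h' : 2 * (k : ℤ) ≤ n := by exact_mod_cast h
  -- This product is the value of the quadratic bound at `k` minus its value at `m`.
  nlinarith [mul_nonneg (sub_nonneg.2 hmk) (by linarith : (0 : ℤ) ≤ 2 * (n - k) - (m + k - 1))]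

theorem crLinear_le_choose_two {n : ℕ} (π : Partitions n) (hk : π.parts.card ≤ n) :
    crLinear π ≤ (n - π.parts.card).choose 2 := by
  obtain ⟨m, hm0, -, hma, hm⟩ := exists_two_mul_crLinear_le π
  have hc := two_mul_choose_two (n - π.parts.card)
  rw [Nat.cast_sub hk] at hc
  zify
  generalize ((n : ℤ) - π.parts.card) = a at *
  rcases hma.eq_or_lt with rfl | hlt
  · linarith
  · nlinarith [mul_nonneg (sub_nonneg.2 hma) (by linarith : (0 : ℤ) ≤ a - m - 1)]

/-- With `q` the number of blocks of size at least three. -/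
theorem exists_two_mul_crCircular_le {n : ℕ} (π : Partitions n) :
    ∃ q : ℤ, 0 ≤ q ∧ 2 * q ≤ n - π.parts.card ∧ (2 * π.parts.card < n → 1 ≤ q) ∧
      2 * (crCircular π : ℤ) ≤
        (n - π.parts.card) * (n - π.parts.card - 1) + 2 * q * (q - 2) := by
  set y : Finset ℕ → ℤ := fun A => if 3 ≤ A.card then 1 else 0 with hy
  set z : Finset ℕ → ℤ := fun A => if A.card = 2 then 1 else 0 with hz
  set s : Finset ℕ → ℤ := fun A => if 3 ≤ A.card then (A.card : ℤ) else 0 with hs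
  have hsum : ∑ A ∈ π.parts, s A - ∑ A ∈ π.parts, y A + ∑ A ∈ π.parts, z A =
      n - π.parts.card := by
    rw [← sum_card_sub_one_parts π, ← Finset.sum_sub_distrib, ← Finset.sum_add_distrib]
    refine Finset.sum_congr rfl fun A hA => ?_
    have := one_le_card_of_mem_parts π hA
    simp only [hy, hz, hs]
    split_ifs <;> omega
  have hys : 3 * ∑ A ∈ π.parts, y A ≤ ∑ A ∈ π.parts, s A := by
    rw [Finset.mul_sum]
    refine Finset.sum_le_sum fun A _ => ?_
    simp only [hy, hs]
    split_ifs <;> omega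
  have hy0 : 0 ≤ ∑ A ∈ π.parts, y A := Finset.sum_nonneg fun A _ => by
    simp only [hy]; split_ifs <;> simp
  have hz0 : 0 ≤ ∑ A ∈ π.parts, z A := Finset.sum_nonneg fun A _ => by
    simp only [hz]; split_ifs <;> simp
  refine ⟨∑ A ∈ π.parts, y A, hy0, by linarith, fun hn => ?_, ?_⟩
  -- Without blocks of size at least three, `n ≤ 2k`.
  · by_contra hlt
    have h0 : ∑ A ∈ π.parts, y A = 0 := by omega
    rw [Finset.sum_eq_zero_iff_of_nonneg fun A _ => by
      simp only [hy]; split_ifs <;> simp] at h0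
    have h1 : ∑ A ∈ π.parts, (A.card : ℤ) ≤ ∑ A ∈ π.parts, 2 :=
      Finset.sum_le_sum fun A hA => by
        have := h0 A hA
        simp only [hy] at this
        split_ifs at this <;> omega
    rw [sum_card_parts, Finset.sum_const, nsmul_eq_mul] at h1
    have : (n : ℤ) ≤ ((2 * π.parts.card : ℕ) : ℤ) := by push_cast; linarith
    omega
  -- The weight is `|A| + |B|` (at least twice the minimum) for two large blocks, `2` for a large
  -- block and a pair, `1` for two pairs, and `0` if a singleton occurs.
  · have h := two_mul_crossings_biUnion_le π.parts blockChords
      (fun A B => s A * y B + y A * s B + (2 * y A) * z B + z A * (2 * y B) + z A * z B)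
      (fun A _ => crossCount_blockChords_self A) (fun A hA B hB hAB => ?_)
    · have hd : ∑ A ∈ π.parts, (s A * y A + y A * s A + (2 * y A) * z A + z A * (2 * y A) +
          z A * z A) = 2 * ∑ A ∈ π.parts, s A + ∑ A ∈ π.parts, z A := by
        rw [Finset.mul_sum, ← Finset.sum_add_distrib]
        refine Finset.sum_congr rfl fun A hA => ?_
        simp only [hy, hz, hs]
        split_ifs <;> omega
      simp only [hd] at h
      simp only [Finset.sum_add_distrib, sum_sum_mul] at h
      simp only [← Finset.mul_sum] at h
      rw [← hsum]
      refine h.trans ?_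
      clear h hd hsum
      generalize ∑ A ∈ π.parts, y A = q at *
      generalize ∑ A ∈ π.parts, z A = d at *
      -- `G` is the excess of the large blocks over size three; `G = 0` makes the inequality an
      -- equality.
      obtain ⟨G, hG⟩ : ∃ G, G = ∑ A ∈ π.parts, s A - 3 * q := ⟨_, rfl⟩
      rw [show ∑ A ∈ π.parts, s A = 3 * q + G by linarith]
      have hG0 : 0 ≤ G := by linarith
      nlinarith [mul_nonneg hG0 hG0, mul_nonneg hG0 hy0, mul_nonneg hG0 hz0]
    · have hdisj := disjoint_of_mem_parts π hA hB hAB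
      have h1 := one_le_card_of_mem_parts π hA
      have h2 := one_le_card_of_mem_parts π hB
      have h3 := crossCount_blockChords_add_le hdisj
      have h4 := crossCount_blockChords_add_le hdisj.symm
      have h5 := card_blockChords_le A
      have h6 := card_blockChords_le B
      rcases h1.eq_or_lt with hA1 | hA1
      · rw [blockChords_eq_empty (B := A) (by omega)]
        simp [hy, hz, hs, ← hA1]
      rcases h2.eq_or_lt with hB1 | hB1
      · rw [blockChords_eq_empty (B := B) (by omega)]
        simp [hy, hz, hs, ← hB1]
      by_cases hA3 : 3 ≤ A.card
      · by_cases hB3 : 3 ≤ B.card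
        · have hA2 : A.card ≠ 2 := by omega
          have hB2 : B.card ≠ 2 := by omega
          simp only [hy, hz, hs, hA3, hB3, hA2, hB2, if_true, if_false]
          push_cast
          omega
        · have hA2 : A.card ≠ 2 := by omega
          have hB2 : B.card = 2 := by omega
          have := card_blockChords_of_card_eq_two hB2
          simp only [hy, hz, hs, hA3, hA2, hB2, if_true, if_false]
          push_cast
          omega
      · have hA2 : A.card = 2 := by omega
        have h7 := card_blockChords_of_card_eq_two hA2
        by_cases hB3 : 3 ≤ B.card
        · have hB2 : B.card ≠ 2 := by omega
          simp only [hy, hz, hs, hB3, hA2, hB2, if_true, if_false]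
          push_cast
          omega
        · have hB2 : B.card = 2 := by omega
          have h8 := card_blockChords_of_card_eq_two hB2
          have := (crossCount_blockChords_add_le_mul (A := A) (B := B)).trans
            (Nat.mul_le_mul h7 h8)
          simp only [hy, hz, hs, hA2, hB2, if_true]
          push_cast
          omega

/-- The function `x ↦ (x mod k)(k - x mod k)` is subadditive: adding `g` to a residue `r` loses
`2gr` without wrap-around and `2(k-g)(k-r)` with it. -/
theorem mod_mul_sub_mod_le (k : ℕ) (ι : Type*) (s : Finset ι) (g : ι → ℕ)
    (hg : ∀ i ∈ s, g i ≤ k) :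
    (((∑ i ∈ s, g i) % k : ℕ) : ℤ) * (k - ((∑ i ∈ s, g i) % k : ℕ)) ≤
      ∑ i ∈ s, (g i : ℤ) * (k - g i) := by
  classical
  induction s using Finset.induction_on with
  | empty => simp
  | insert a s ha ih =>
    rw [Finset.sum_insert ha, Finset.sum_insert ha]
    have ih' := ih fun i hi => hg i (Finset.mem_insert_of_mem hi)
    have hga := hg a (Finset.mem_insert_self a s)
    refine le_trans ?_ (add_le_add_right ih' _)
    rcases Nat.eq_zero_or_pos k with rfl | hk
    · have : g a = 0 := by omega
      simp [this]
    have hr := Nat.mod_lt (∑ i ∈ s, g i) hk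
    have hmod : (g a + ∑ i ∈ s, g i) % k = (g a + (∑ i ∈ s, g i) % k) % k := by simp
    rw [hmod]
    generalize (∑ i ∈ s, g i) % k = r at *
    rcases lt_or_ge (g a + r) k with h | h
    · rw [Nat.mod_eq_of_lt h]
      push_cast
      nlinarith [mul_nonneg (Int.natCast_nonneg (g a)) (Int.natCast_nonneg r)]
    · rw [Nat.mod_eq_sub_mod h, Nat.mod_eq_of_lt (by omega), Nat.cast_sub h]
      zify at hga hr
      push_cast
      nlinarith [mul_nonneg (sub_nonneg.2 hga) (sub_nonneg.2 hr.le)]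

theorem crCircular_le {n : ℕ} (π : Partitions n) :
    (crCircular π : ℤ) ≤ ((π.parts.card : ℤ) - 1) * n -
      ((n % π.parts.card : ℕ) : ℤ) * (π.parts.card - ((n % π.parts.card : ℕ) : ℤ)) := by
  have hle : ∀ A ∈ π.parts, A.card ≤ n := fun A hA => by
    have := Finset.card_le_card (π.le hA)
    simpa using this
  -- Layer-cake decomposition: `u l A` marks the blocks with more than `l` elements, so the minimum
  -- of two sizes is the sum over `l` of products of marks.
  set u : ℕ → Finset ℕ → ℕ := fun l A => if l < A.card then 1 else 0 with hu
  have hcard : ∀ c, c ≤ n → ∑ l ∈ Finset.range n, (if l < c then 1 else 0 : ℕ) = c := by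
    intro c hc
    rw [← Finset.card_filter]
    have : (Finset.range n).filter (fun l => l < c) = Finset.range c := by
      ext l
      simp only [Finset.mem_filter, Finset.mem_range]
      omega
    rw [this, Finset.card_range]
  have hg : ∑ l ∈ Finset.range n, ∑ A ∈ π.parts, u l A = n := by
    rw [Finset.sum_comm]
    rw [Finset.sum_congr rfl fun A hA => hcard _ (hle A hA)]
    exact_mod_cast sum_card_parts π
  have hgk : ∀ l ∈ Finset.range n, ∑ A ∈ π.parts, u l A ≤ π.parts.card := by
    intro l _
    rw [Finset.card_eq_sum_ones]
    exact Finset.sum_le_sum fun A _ => by simp only [hu]; split_ifs <;> simp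
  have hφ := mod_mul_sub_mod_le π.parts.card ℕ (Finset.range n) _ hgk
  rw [hg] at hφ
  have hmin : ∀ A ∈ π.parts, ∀ B ∈ π.parts, (min A.card B.card : ℕ) =
      ∑ l ∈ Finset.range n, u l A * u l B := by
    intro A hA B hB
    rw [← hcard (min A.card B.card) ((min_le_left _ _).trans (hle A hA))]
    refine Finset.sum_congr rfl fun l _ => ?_
    simp only [hu, lt_min_iff]
    split_ifs <;> simp_all
  have h := two_mul_crossings_biUnion_le π.parts blockChords
      (fun A B => 2 * (min A.card B.card : ℕ))
      (fun A _ => crossCount_blockChords_self A) (fun A hA B hB hAB => ?_)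
  · have h1 : ∑ A ∈ π.parts, ∑ B ∈ π.parts, (2 * (min A.card B.card : ℕ) : ℤ) =
        2 * ∑ l ∈ Finset.range n, ((∑ A ∈ π.parts, u l A : ℕ) : ℤ) ^ 2 := by
      rw [Finset.sum_congr rfl fun A hA => Finset.sum_congr rfl fun B hB => by
        rw [hmin A hA B hB]]
      simp only [← Finset.mul_sum]
      congr 1
      push_cast
      simp only [pow_two, Finset.sum_mul_sum]
      exact (Finset.sum_congr rfl fun A _ => Finset.sum_comm).trans Finset.sum_comm
    have h2 : ∑ A ∈ π.parts, (2 * (min A.card A.card : ℕ) : ℤ) = 2 * n := by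
      simp only [min_self]
      rw [← Finset.mul_sum, sum_card_parts]
    rw [h1, h2] at h
    have h3 : ∑ l ∈ Finset.range n, ((∑ A ∈ π.parts, u l A : ℕ) : ℤ) *
        (π.parts.card - (∑ A ∈ π.parts, u l A : ℕ)) = π.parts.card * n -
        ∑ l ∈ Finset.range n, ((∑ A ∈ π.parts, u l A : ℕ) : ℤ) ^ 2 := by
      have hg' : ∑ l ∈ Finset.range n, ((∑ A ∈ π.parts, u l A : ℕ) : ℤ) = n := by
        exact_mod_cast hg
      conv_rhs => rw [← hg']
      rw [Finset.mul_sum, ← Finset.sum_sub_distrib]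
      exact Finset.sum_congr rfl fun l _ => by ring
    rw [h3] at hφ
    have h4 : 2 * (crCircular π : ℤ) ≤ _ := h
    linarith
  · have hdisj := disjoint_of_mem_parts π hA hB hAB
    have h3 := crossCount_blockChords_add_le hdisj
    have h4 := crossCount_blockChords_add_le hdisj.symm
    have h5 := card_blockChords_le A
    have h6 := card_blockChords_le B
    push_cast
    omega

/-! ### The residue-class partition -/

/-- Elements of `[N]` are coloured by their residue modulo `m`, the others by themselves. -/
def residueSetoid (m N : ℕ) : Setoid ℕ :=
  Setoid.ker fun i => if i ≤ N then i % m else i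

instance (m N : ℕ) : DecidableRel (residueSetoid m N).r := fun a b =>
  decEq (if a ≤ N then a % m else a) (if b ≤ N then b % m else b)

/-- The partition of `[n]` into the residue classes modulo `m` of `[N]` and singletons. -/
def residuePartition (n m N : ℕ) : Partitions n :=
  Finpartition.ofSetSetoid (residueSetoid m N) (Finset.Icc 1 n)

theorem parts_residuePartition (n m N : ℕ) : (residuePartition n m N).parts =
    (Finset.Icc 1 n).image fun i => (Finset.Icc 1 n).filter fun j =>
      (if i ≤ N then i % m else i) = if j ≤ N then j % m else j := by
  ext A
  simp only [residuePartition, Finpartition.ofSetSetoid, Finset.mem_image]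
  refine exists_congr fun i => and_congr_right fun _ => ?_
  rw [show ((Finset.Icc 1 n).filter fun j => (residueSetoid m N).r i j) =
    (Finset.Icc 1 n).filter fun j => (if i ≤ N then i % m else i) =
      if j ≤ N then j % m else j from Finset.filter_congr fun j _ => Iff.rfl]

theorem filter_mem_parts_residuePartition {n m N i : ℕ} (hi : i ∈ Finset.Icc 1 n) :
    ((Finset.Icc 1 n).filter fun j => (if i ≤ N then i % m else i) =
      if j ≤ N then j % m else j) ∈ (residuePartition n m N).parts := by
  rw [parts_residuePartition]
  exact Finset.mem_image_of_mem _ hi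

theorem card_parts_residuePartition {n m N : ℕ} (hm : 1 ≤ m) (hmN : m ≤ N) (hN : N ≤ n) :
    (residuePartition n m N).parts.card = m + (n - N) := by
  have h : (residuePartition n m N).parts =
      (Finset.Icc 1 m ∪ Finset.Icc (N + 1) n).image fun i => (Finset.Icc 1 n).filter fun j =>
      (if i ≤ N then i % m else i) = if j ≤ N then j % m else j := by
    ext A
    constructor
    · rw [parts_residuePartition, Finset.mem_image, Finset.mem_image]
      rintro ⟨i, hi, rfl⟩
      rw [Finset.mem_Icc] at hi
      by_cases hiN : i ≤ N
      -- The representative of a residue class is taken in `1, …, m` rather than `0, …, m - 1`,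
      -- whence the shift by one.
      · have h1 := Nat.mod_lt (i - 1) (by omega : m > 0)
        have h2 : ((i - 1) % m + 1) % m = i % m := by
          conv_rhs => rw [show i = i - 1 + 1 by omega]
          simp
        refine ⟨(i - 1) % m + 1, ?_, ?_⟩
        · simp only [Finset.mem_union, Finset.mem_Icc]
          omega
        · rw [if_pos (by omega), h2, if_pos hiN]
      · exact ⟨i, by simp; omega, rfl⟩
    · rw [Finset.mem_image]
      rintro ⟨i, hi, rfl⟩
      simp only [Finset.mem_union, Finset.mem_Icc] at hi
      exact filter_mem_parts_residuePartition (Finset.mem_Icc.2 (by omega))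
  rw [h, Finset.card_image_of_injOn, Finset.card_union_of_disjoint]
  · simp
  · rw [Finset.disjoint_left]
    intro x
    simp only [Finset.mem_Icc]
    omega
  · intro i hi j hj hij
    simp only [Finset.coe_union, Finset.coe_Icc, Set.mem_union, Set.mem_Icc] at hi hj
    have hmem : j ∈ (Finset.Icc 1 n).filter fun x => (if i ≤ N then i % m else i) =
        if x ≤ N then x % m else x := by
      simp only at hij
      rw [hij, Finset.mem_filter, Finset.mem_Icc]
      exact ⟨by omega, rfl⟩
    have h1 := (Finset.mem_filter.1 hmem).2
    have h2 := Nat.mod_lt i (by omega : m > 0)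
    have h3 := Nat.mod_lt j (by omega : m > 0)
    have h4 : ∀ x, 1 ≤ x → x ≤ m → x % m = if x = m then 0 else x := by
      intro x hx hxm
      split_ifs with h
      · simp [h]
      · exact Nat.mod_eq_of_lt (by omega)
    rcases hi with hi | hi <;> rcases hj with hj | hj
    · rw [if_pos (by omega), if_pos (by omega), h4 i hi.1 hi.2, h4 j hj.1 hj.2] at h1
      split_ifs at h1 <;> omega
    · rw [if_pos (by omega), if_neg (by omega)] at h1
      omega
    · rw [if_neg (by omega), if_pos (by omega)] at h1
      omega
    · rw [if_neg (by omega), if_neg (by omega)] at h1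
      omega

theorem mem_arcs_residuePartition {n m N i : ℕ} (hm : 1 ≤ m) (hN : N ≤ n) (hi : 1 ≤ i)
    (hiN : i + m ≤ N) : (i, i + m) ∈ arcs (residuePartition n m N) := by
  refine Finset.mem_biUnion.2 ⟨_, filter_mem_parts_residuePartition (i := i)
    (Finset.mem_Icc.2 (by omega)), mem_blockArcs.2 ⟨⟨?_, ?_⟩, by simp; omega, ?_⟩⟩
  · simp only [Finset.mem_filter, Finset.mem_Icc, and_true]
    omega
  · simp only [Finset.mem_filter, Finset.mem_Icc]
    rw [if_pos (by omega), if_pos hiN]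
    simp; omega
  · intro x hx
    by_contra! hlt
    simp only [Finset.mem_filter, Finset.mem_Icc] at hx hlt
    rw [if_pos (by omega), if_pos (by omega)] at hx
    have h1 : (x - i) % m = 0 := Nat.sub_mod_eq_zero_of_mod_eq hx.2.symm
    rw [Nat.mod_eq_of_lt (by omega)] at h1
    omega

theorem arcs_subset_chords {n : ℕ} (π : Partitions n) : arcs π ⊆ chords π :=
  Finset.biUnion_mono fun B _ => blockArcs_subset_blockChords B

theorem mem_chords_residuePartition {n m N j l : ℕ} (hm : 1 ≤ m) (hN : N ≤ n) (hj : 1 ≤ j)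
    (hjm : j ≤ m) (hjl : j < l) (hl : N < l + m) (hlN : l ≤ N) (hmod : l % m = j % m) :
    (j, l) ∈ chords (residuePartition n m N) := by
  refine Finset.mem_biUnion.2 ⟨_, filter_mem_parts_residuePartition (i := j)
    (Finset.mem_Icc.2 (by omega)), mem_blockChords.2 ⟨⟨?_, ?_⟩, hjl, Or.inr ?_⟩⟩
  · simp only [Finset.mem_filter, Finset.mem_Icc, and_true]
    omega
  · simp only [Finset.mem_filter, Finset.mem_Icc]
    rw [if_pos (by omega), if_pos hlN, hmod]
    exact ⟨by omega, rfl⟩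
  · intro x hx
    simp only [Finset.mem_filter, Finset.mem_Icc] at hx ⊢
    have hxN : x ≤ N := by
      by_contra h
      have h1 := Nat.mod_lt j (by omega : m > 0)
      have h2 : (l - j) % m = 0 := Nat.sub_mod_eq_zero_of_mod_eq hmod
      have h3 : m ≤ l - j := Nat.le_of_dvd (by omega) (Nat.dvd_of_mod_eq_zero h2)
      rw [if_pos (by omega), if_neg h] at hx
      omega
    rw [if_pos (by omega), if_pos hxN] at hx
    constructor
    · by_contra! hlt
      have h1 : (j - x) % m = 0 := Nat.sub_mod_eq_zero_of_mod_eq hx.2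
      rw [Nat.mod_eq_of_lt (by omega)] at h1
      omega
    · by_contra! hlt
      have h1 : (x - l) % m = 0 := Nat.sub_mod_eq_zero_of_mod_eq (hx.2.symm.trans hmod.symm)
      rw [Nat.mod_eq_of_lt (by omega)] at h1
      omega

/-! ### Crossings among pairs of constant length -/

theorem crossings_mono {S T : Finset (ℕ × ℕ)} (h : S ⊆ T) : crossings S ≤ crossings T :=
  crossCount_mono h h

theorem crLinear_le_crCircular {n : ℕ} (π : Partitions n) : crLinear π ≤ crCircular π :=
  crossings_mono (arcs_subset_chords π)

theorem crossCount_union_left {S S' T : Finset (ℕ × ℕ)} (h : Disjoint S S') :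
    crossCount (S ∪ S') T = crossCount S T + crossCount S' T := by
  rw [crossCount, Finset.union_product, Finset.filter_union, Finset.card_union_of_disjoint]
  · rfl
  · exact Finset.disjoint_filter_filter (Finset.disjoint_product.2 (Or.inl h))

theorem crossCount_union_right {S T T' : Finset (ℕ × ℕ)} (h : Disjoint T T') :
    crossCount S (T ∪ T') = crossCount S T + crossCount S T' := by
  rw [crossCount, Finset.product_union, Finset.filter_union, Finset.card_union_of_disjoint]
  · rfl
  · exact Finset.disjoint_filter_filter (Finset.disjoint_product.2 (Or.inr h))

/-- The pairs `(i, i + d)` with `a < i ≤ b`. -/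
def shiftPairs (a b d : ℕ) : Finset (ℕ × ℕ) := (Finset.Ioc a b).image fun i => (i, i + d)

theorem mem_shiftPairs {a b d : ℕ} {e : ℕ × ℕ} :
    e ∈ shiftPairs a b d ↔ (a < e.1 ∧ e.1 ≤ b) ∧ e.2 = e.1 + d := by
  obtain ⟨x, y⟩ := e
  simp only [shiftPairs, Finset.mem_image, Finset.mem_Ioc, Prod.mk.injEq]
  constructor
  · rintro ⟨i, hi, rfl, rfl⟩
    exact ⟨hi, rfl⟩
  · rintro ⟨hi, rfl⟩
    exact ⟨x, hi, rfl, rfl⟩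

theorem crossCount_shiftPairs (a b d a' b' d' : ℕ) :
    crossCount (shiftPairs a b d) (shiftPairs a' b' d') =
      ∑ j ∈ Finset.Ioc a' b', ((Finset.Ioc a b).filter fun i =>
        i < j ∧ j < i + d ∧ i + d < j + d').card := by
  rw [crossCount, Finset.card_filter, Finset.sum_product_right, shiftPairs, shiftPairs,
    Finset.sum_image (fun x _ y _ h => (Prod.mk.inj h).1)]
  refine Finset.sum_congr rfl fun j _ => ?_
  rw [Finset.sum_image (fun x _ y _ h => (Prod.mk.inj h).1), Finset.card_filter]

/-- For each second pair, an interval `(f j, g j]` of left ends giving crossings is exhibited. -/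
theorem le_crossCount_shiftPairs {a b d a' b' d' : ℕ} (f : ℕ → ℕ) (g : ℕ → ℕ)
    (h : ∀ j, a' < j → j ≤ b' → ∀ i, f j < i → i ≤ g j →
      (a < i ∧ i ≤ b) ∧ i < j ∧ j < i + d ∧ i + d < j + d') :
    ∑ j ∈ Finset.Ioc a' b', (g j - f j) ≤
      crossCount (shiftPairs a b d) (shiftPairs a' b' d') := by
  rw [crossCount_shiftPairs]
  refine Finset.sum_le_sum fun j hj => ?_
  rw [← Nat.card_Ioc]
  refine Finset.card_le_card fun i hi => ?_
  rw [Finset.mem_Ioc] at hi hj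
  rw [Finset.mem_filter, Finset.mem_Ioc]
  exact h j hj.1 hj.2 i hi.1 hi.2

theorem two_mul_sum_Ioc (a b : ℕ) (h : a ≤ b) (c : ℤ) (e : ℤ) :
    2 * ∑ j ∈ Finset.Ioc a b, (c + e * j) = (b - a) * (2 * c + e * (a + b + 1)) := by
  induction b, h using Nat.le_induction with
  | base => simp
  | succ b hb ih =>
    rw [← Finset.insert_Ioc_right_eq_Ioc_add_one hb, Finset.sum_insert (by simp), mul_add, ih]
    push_cast
    ring

theorem shiftPairs_subset_arcs {n m N : ℕ} (hm : 1 ≤ m) (hN : N ≤ n) :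
    shiftPairs 0 (N - m) m ⊆ arcs (residuePartition n m N) := by
  rintro ⟨x, y⟩ he
  rw [mem_shiftPairs] at he
  obtain ⟨⟨h1, h2⟩, rfl⟩ : (0 < x ∧ x ≤ N - m) ∧ y = x + m := he
  exact mem_arcs_residuePartition hm hN h1 (by omega)

/-- The pairs `(i, i + m)` with `i ≤ a` where `m ≤ a`. -/
theorem two_mul_crossCount_arcs_ge {a m : ℕ} (hm : 1 ≤ m) (hma : m ≤ a) :
    2 * ((m : ℤ) - 1) * a - m * (m - 1) ≤
      2 * (crossCount (shiftPairs 0 a m) (shiftPairs 0 a m) : ℤ) := by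
  have h := le_crossCount_shiftPairs (a := 0) (b := a) (d := m) (a' := 0) (b' := a) (d' := m)
    (fun j => j - m) (fun j => j - 1) (by intro j _ _ i hi hj; omega)
  have h2 : ∑ j ∈ Finset.Ioc 0 a, ((j - 1 : ℕ) - (j - m : ℕ)) =
      ∑ j ∈ Finset.Ioc 0 m, (j - 1) + ∑ j ∈ Finset.Ioc m a, (m - 1) := by
    rw [← Finset.sum_Ioc_consecutive _ (Nat.zero_le m) hma]
    congr 1 <;> refine Finset.sum_congr rfl fun j hj => ?_ <;> rw [Finset.mem_Ioc] at hj <;> omega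
  rw [h2] at h
  zify at h
  have h3 : ∑ j ∈ Finset.Ioc 0 m, ((j - 1 : ℕ) : ℤ) = ∑ j ∈ Finset.Ioc 0 m, ((-1 : ℤ) + 1 * j) :=
    Finset.sum_congr rfl fun j hj => by rw [Finset.mem_Ioc] at hj; omega
  have h4 := two_mul_sum_Ioc 0 m (Nat.zero_le m) (-1) 1
  rw [h3, Finset.sum_const, Nat.card_Ioc, nsmul_eq_mul, Nat.cast_sub hma, Nat.cast_sub hm] at h
  push_cast at h h4
  nlinarith

theorem two_mul_crLinear_residuePartition_ge {n m N : ℕ} (hm : 1 ≤ m) (hmN : 2 * m ≤ N)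
    (hN : N ≤ n) : 2 * ((m : ℤ) - 1) * (N - m) - m * (m - 1) ≤
      2 * (crLinear (residuePartition n m N) : ℤ) := by
  have h1 := two_mul_crossCount_arcs_ge hm (by omega : m ≤ N - m)
  have h2 : crossCount _ _ ≤ crLinear (residuePartition n m N) :=
    crossings_mono (shiftPairs_subset_arcs hm hN)
  rw [Nat.cast_sub (by omega)] at h1
  zify at h2
  linarith

theorem shiftPairs_subset_chords_long {n m q r : ℕ} (hm : 1 ≤ m) (hq : 1 ≤ q) (hr : r < m)
    (hn : q * m + r ≤ n) :
    shiftPairs 0 r (q * m) ⊆ chords (residuePartition n m (q * m + r)) := by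
  rintro ⟨x, y⟩ he
  rw [mem_shiftPairs] at he
  obtain ⟨⟨h1, h2⟩, rfl⟩ : (0 < x ∧ x ≤ r) ∧ y = x + q * m := he
  have := Nat.mul_pos hq hm
  exact mem_chords_residuePartition hm hn h1 (by omega) (by omega) (by omega) (by omega) (by simp)

theorem shiftPairs_subset_chords_short {n m q r : ℕ} (hm : 1 ≤ m) (hq : 1 ≤ q)
    (hn : (q + 1) * m + r ≤ n) :
    shiftPairs r m (q * m) ⊆ chords (residuePartition n m ((q + 1) * m + r)) := by
  rintro ⟨x, y⟩ he
  rw [mem_shiftPairs] at he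
  obtain ⟨⟨h1, h2⟩, rfl⟩ : (r < x ∧ x ≤ m) ∧ y = x + q * m := he
  have := Nat.mul_pos hq hm
  have h3 : (q + 1) * m = q * m + m := by ring
  exact mem_chords_residuePartition hm hn (by omega) (by omega) (by omega) (by omega) (by omega)
    (by simp)

theorem disjoint_shiftPairs {a b d a' b' d' : ℕ} (h : d ≠ d') :
    Disjoint (shiftPairs a b d) (shiftPairs a' b' d') := by
  rw [Finset.disjoint_left]
  intro e h1 h2
  rw [mem_shiftPairs] at h1 h2
  omega

/-- Pairs of equal length at least the number of left ends all cross. -/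
theorem two_mul_crossCount_self_ge {a b d : ℕ} (hab : a ≤ b) (h : b ≤ a + d) :
    ((b : ℤ) - a) * (b - a - 1) ≤
      2 * (crossCount (shiftPairs a b d) (shiftPairs a b d) : ℤ) := by
  have h := le_crossCount_shiftPairs (a := a) (b := b) (d := d) (a' := a) (b' := b) (d' := d)
    (fun _ => a) (fun j => j - 1) (by intro j _ _ i hi hj; omega)
  have h3 : ∑ j ∈ Finset.Ioc a b, ((j - 1 - a : ℕ) : ℤ) =
      ∑ j ∈ Finset.Ioc a b, ((-1 - a : ℤ) + 1 * j) :=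
    Finset.sum_congr rfl fun j hj => by rw [Finset.mem_Ioc] at hj; omega
  have h4 := two_mul_sum_Ioc a b hab (-1 - a) 1
  zify at h
  rw [h3] at h
  nlinarith

/-- Short pairs followed by long ones. -/
theorem two_mul_crossCount_short_long_ge {m c a b d : ℕ} (hab : a ≤ b) (hb : b ≤ m) (hbc : b ≤ c)
    (hd : m ≤ d) : ((b : ℤ) - a) * (b + a - 1) ≤
      2 * (crossCount (shiftPairs 0 c m) (shiftPairs a b d) : ℤ) := by
  have h := le_crossCount_shiftPairs (a := 0) (b := c) (d := m) (a' := a) (b' := b) (d' := d)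
    (fun _ => 0) (fun j => j - 1) (by intro j _ _ i hi hj; omega)
  have h3 : ∑ j ∈ Finset.Ioc a b, ((j - 1 - 0 : ℕ) : ℤ) =
      ∑ j ∈ Finset.Ioc a b, ((-1 : ℤ) + 1 * j) :=
    Finset.sum_congr rfl fun j hj => by rw [Finset.mem_Ioc] at hj; omega
  have h4 := two_mul_sum_Ioc a b hab (-1) 1
  zify at h
  rw [h3] at h
  nlinarith

theorem le_crossCount_shiftPairs_left {a b d a' b' d' : ℕ} (f : ℕ → ℕ) (g : ℕ → ℕ)
    (h : ∀ i, a < i → i ≤ b → ∀ j, f i < j → j ≤ g i →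
      (a' < j ∧ j ≤ b') ∧ i < j ∧ j < i + d ∧ i + d < j + d') :
    ∑ i ∈ Finset.Ioc a b, (g i - f i) ≤
      crossCount (shiftPairs a b d) (shiftPairs a' b' d') := by
  have hswap := Finset.sum_comm (s := Finset.Ioc a' b') (t := Finset.Ioc a b)
    (f := fun j i => if i < j ∧ j < i + d ∧ i + d < j + d' then 1 else 0)
  simp only [← Finset.card_filter] at hswap
  rw [crossCount_shiftPairs, hswap]
  refine Finset.sum_le_sum fun i hi => ?_
  rw [← Nat.card_Ioc]
  refine Finset.card_le_card fun j hj => ?_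
  rw [Finset.mem_Ioc] at hi hj
  rw [Finset.mem_filter, Finset.mem_Ioc]
  exact h i hi.1 hi.2 j hj.1 hj.2

/-- Long pairs, with right ends near the end `c + m` of the interval, followed by short ones. -/
theorem two_mul_crossCount_long_short_ge {m c a b d : ℕ} (hab : a ≤ b) (hd : m ≤ d)
    (hc : b + d ≤ c + m) (hc' : c < a + 1 + d) :
    ((b : ℤ) - a) * (2 * (c + m - d) - a - b - 1) ≤
      2 * (crossCount (shiftPairs a b d) (shiftPairs 0 c m) : ℤ) := by
  have h := le_crossCount_shiftPairs_left (a := a) (b := b) (d := d) (a' := 0) (b' := c) (d' := m)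
    (fun i => i + d - m) (fun _ => c) (by intro i _ _ j hi hj; omega)
  have h3 : ∑ i ∈ Finset.Ioc a b, ((c - (i + d - m) : ℕ) : ℤ) =
      ∑ i ∈ Finset.Ioc a b, ((c + m - d : ℤ) + (-1) * i) :=
    Finset.sum_congr rfl fun j hj => by rw [Finset.mem_Ioc] at hj; omega
  have h4 := two_mul_sum_Ioc a b hab (c + m - d) (-1)
  zify at h
  rw [h3] at h
  nlinarith

/-- Here `r` classes have `q + 1` elements and `m - r` have `q`, with closing chords of lengths `qm`
and `(q-1)m`. Since `q ≥ 3`, these differ from the arc length `m`, so the three families are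
disjoint. -/
theorem crCircular_residuePartition_ge {n m q r : ℕ} (hm : 1 ≤ m) (hq : 3 ≤ q) (hr : r < m)
    (hn : q * m + r ≤ n) : ((m : ℤ) - 1) * (q * m + r) - r * (m - r) ≤
      crCircular (residuePartition n m (q * m + r)) := by
  obtain ⟨p, rfl⟩ : ∃ p, q = p + 1 := ⟨q - 1, by omega⟩
  have hmp : m * 2 ≤ p * m := by rw [mul_comm]; exact Nat.mul_le_mul_right m (by omega)
  have hpm : (p + 1) * m = p * m + m := by ring
  have hA := shiftPairs_subset_arcs (m := m) hm hn
  have hL := shiftPairs_subset_chords_long hm (by omega) hr hn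
  have hS := shiftPairs_subset_chords_short (r := r) hm (by omega : 1 ≤ p) hn
  rw [hpm] at hA hL hS ⊢
  have hc : p * m + m + r - m = p * m + r := by omega
  rw [hc] at hA
  have hle := crossings_mono (Finset.union_subset (Finset.union_subset
    (hA.trans (arcs_subset_chords _)) hL) hS)
  have d1 : Disjoint (shiftPairs 0 (p * m + r) m) (shiftPairs 0 r (p * m + m)) :=
    disjoint_shiftPairs (by omega)
  have d2 : Disjoint (shiftPairs 0 (p * m + r) m ∪ shiftPairs 0 r (p * m + m))
      (shiftPairs r m (p * m)) :=
    Finset.disjoint_union_left.2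
      ⟨disjoint_shiftPairs (by omega), disjoint_shiftPairs (by omega)⟩
  change crossCount _ _ ≤ crCircular _ at hle
  -- Of the nine resulting terms, the two mixing both kinds of closing chord are dropped: such
  -- chords are nested.
  rw [crossCount_union_left d2, crossCount_union_left d1, crossCount_union_right d2,
    crossCount_union_right d1, crossCount_union_right d2, crossCount_union_right d1,
    crossCount_union_right d2, crossCount_union_right d1] at hle
  have e1 := two_mul_crossCount_arcs_ge (a := p * m + r) hm (by omega)
  have e2 := two_mul_crossCount_self_ge (a := 0) (b := r) (d := p * m + m) (by omega) (by omega)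
  have e3 := two_mul_crossCount_self_ge (a := r) (b := m) (d := p * m) (by omega) (by omega)
  have e4 := two_mul_crossCount_short_long_ge (m := m) (c := p * m + r) (a := 0) (b := r)
    (d := p * m + m) (by omega) (by omega) (by omega) (by omega)
  have e5 := two_mul_crossCount_short_long_ge (m := m) (c := p * m + r) (a := r) (b := m)
    (d := p * m) (by omega) (by omega) (by omega) (by omega)
  have e6 := two_mul_crossCount_long_short_ge (m := m) (c := p * m + r) (a := 0) (b := r)
    (d := p * m + m) (by omega) (by omega) (by omega) (by omega)
  have e7 := two_mul_crossCount_long_short_ge (m := m) (c := p * m + r) (a := r) (b := m)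
    (d := p * m) (by omega) (by omega) (by omega) (by omega)
  zify at hle
  push_cast at *
  nlinarith

/-- The classes are `m` triples and the pair `{m + 1, 2m + 2}`, whose closing chord is its arc, so
only `m` closing chords are added. -/
theorem crCircular_residuePartition_three_mul_sub_one_ge {n m : ℕ} (hn : 3 * m + 2 ≤ n) :
    (m : ℤ) * (3 * m - 1) ≤ crCircular (residuePartition n (m + 1) (3 * m + 2)) := by
  have hN : 2 * (m + 1) + m = 3 * m + 2 := by ring
  have hA := shiftPairs_subset_arcs (m := m + 1) (by omega) hn
  have hL := shiftPairs_subset_chords_long (n := n) (m := m + 1) (q := 2) (r := m) (by omega)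
    (by omega) (by omega) (by omega)
  rw [hN] at hL
  rw [show 3 * m + 2 - (m + 1) = 2 * m + 1 by omega] at hA
  have hle := crossings_mono (Finset.union_subset (hA.trans (arcs_subset_chords _)) hL)
  have d1 : Disjoint (shiftPairs 0 (2 * m + 1) (m + 1)) (shiftPairs 0 m (2 * (m + 1))) :=
    disjoint_shiftPairs (by omega)
  change crossCount _ _ ≤ crCircular _ at hle
  rw [crossCount_union_left d1, crossCount_union_right d1, crossCount_union_right d1] at hle
  have e1 := two_mul_crossCount_arcs_ge (a := 2 * m + 1) (m := m + 1) (by omega) (by omega)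
  have e2 := two_mul_crossCount_self_ge (a := 0) (b := m) (d := 2 * (m + 1)) (by omega) (by omega)
  have e4 := two_mul_crossCount_short_long_ge (m := m + 1) (c := 2 * m + 1) (a := 0) (b := m)
    (d := 2 * (m + 1)) (by omega) (by omega) (by omega) (by omega)
  have e6 := two_mul_crossCount_long_short_ge (m := m + 1) (c := 2 * m + 1) (a := 0) (b := m)
    (d := 2 * (m + 1)) (by omega) (by omega) (by omega) (by omega)
  zify at hle
  push_cast at *
  nlinarith

/-! ### The maxima -/

theorem exists_isMaxOver {n k : ℕ} (hk : 1 ≤ k) (hkn : k ≤ n) (f : Partitions n → ℕ) :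
    ∃ M, IsMaxOver n k f M := by
  have hne : (f '' {π : Partitions n | π.parts.card = k}).Nonempty := by
    refine ⟨_, residuePartition n k n, ?_, rfl⟩
    have := card_parts_residuePartition hk hkn le_rfl
    rw [Set.mem_ofPred_eq]
    omega
  have hfin : (f '' {π : Partitions n | π.parts.card = k}).Finite := (Set.toFinite _).image f
  obtain ⟨M, hM⟩ := hfin.exists_maximal hne
  exact ⟨M, hM.1, fun x hx => by
    rcases le_total x M with h | h
    · exact h
    · exact hM.2 hx h⟩

theorem exists_residuePartition_le {n k m : ℕ} {f : Partitions n → ℕ} {M : ℕ}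
    (hM : IsMaxOver n k f M) (hm : 1 ≤ m) (hmk : m ≤ k) (hkn : k ≤ n) :
    f (residuePartition n m (n - k + m)) ≤ M := by
  refine hM.2 ⟨_, ?_, rfl⟩
  have := card_parts_residuePartition (n := n) (N := n - k + m) hm (by omega) (by omega)
  rw [Set.mem_ofPred_eq]
  omega

theorem linear_max_of_two_mul_le {n k M : ℕ} (hk : 1 ≤ k) (h : 2 * k ≤ n)
    (hM : IsMaxOver n k crLinear M) :
    (M : ℤ) = ((k : ℤ) - 1) * n - 3 * (k.choose 2 : ℤ) := by
  apply le_antisymm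
  · obtain ⟨π, rfl, rfl⟩ := hM.1
    exact crLinear_le_of_le π h
  · have h1 := exists_residuePartition_le hM hk le_rfl (by omega)
    rw [show n - k + k = n by omega] at h1
    have h2 := two_mul_crLinear_residuePartition_ge (n := n) hk h le_rfl
    have h3 := two_mul_choose_two k
    zify at h1
    nlinarith

theorem choose_two_le_crLinear_residuePartition {n a : ℕ} (ha : 1 ≤ a) (h : 2 * a ≤ n) :
    a.choose 2 ≤ crLinear (residuePartition n a (a + a)) := by
  have h2 := two_mul_crLinear_residuePartition_ge (n := n) (N := a + a) ha (by omega) (by omega)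
  have h3 := two_mul_choose_two a
  zify
  push_cast at h2
  nlinarith

/-- With `n - k` pairs, all mutually crossing, and singletons. The parameter `f` lets the same
partition serve both the linear and the circular maximum. -/
theorem choose_two_le_of_le_two_mul {n k M : ℕ} {f : Partitions n → ℕ}
    (hf : ∀ π, crLinear π ≤ f π) (hkn : k ≤ n) (h : n ≤ 2 * k) (hM : IsMaxOver n k f M) :
    (n - k).choose 2 ≤ M := by
  rcases Nat.eq_zero_or_pos (n - k) with h0 | h0
  · simp [h0]
  · exact (choose_two_le_crLinear_residuePartition (n := n) h0 (by omega)).trans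
      ((hf _).trans (exists_residuePartition_le hM h0 (by omega) hkn))

theorem linear_max_of_le_two_mul {n k M : ℕ} (hkn : k ≤ n) (h : n ≤ 2 * k)
    (hM : IsMaxOver n k crLinear M) : M = (n - k).choose 2 := by
  refine le_antisymm ?_ (choose_two_le_of_le_two_mul (fun _ => le_rfl) hkn h hM)
  obtain ⟨π, rfl, rfl⟩ := hM.1
  exact crLinear_le_choose_two π hkn

theorem circular_max_of_three_mul_le {n k M : ℕ} (hk : 1 ≤ k) (h : 3 * k ≤ n)
    (hM : IsMaxOver n k crCircular M) :
    (M : ℤ) = ((k : ℤ) - 1) * n - ((n % k : ℕ) : ℤ) * ((k : ℤ) - ((n % k : ℕ) : ℤ)) := by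
  apply le_antisymm
  · obtain ⟨π, rfl, rfl⟩ := hM.1
    exact crCircular_le π
  · have h1 := exists_residuePartition_le hM hk le_rfl (by omega)
    have hdiv : n / k * k + n % k = n := Nat.div_add_mod' n k
    have h2 := crCircular_residuePartition_ge (n := n) (q := n / k) hk
      ((Nat.le_div_iff_mul_le hk).2 h) (Nat.mod_lt n hk) hdiv.le
    rw [show n - k + k = n by omega] at h1
    rw [hdiv] at h2
    have hdiv' : ((n / k : ℕ) : ℤ) * k + (n % k : ℕ) = n := by exact_mod_cast hdiv
    rw [hdiv'] at h2
    zify at h1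
    linarith

theorem mod_form_eq {n k : ℕ} (M : ℕ)
    (hM : (M : ℤ) = ((k : ℤ) - 1) * n - ((n % k : ℕ) : ℤ) * ((k : ℤ) - ((n % k : ℕ) : ℤ))) :
    M = 2 * k.choose 2 * (n / k) + 2 * (n % k).choose 2 := by
  have hdiv : ((n / k : ℕ) : ℤ) * k + (n % k : ℕ) = n := by exact_mod_cast Nat.div_add_mod' n k
  have h1 := two_mul_choose_two k
  have h2 := two_mul_choose_two (n % k)
  rw [← hdiv] at hM
  zify at h1 h2 ⊢
  push_cast at *
  rw [h1, h2, hM]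
  ring

theorem circular_max_le_choose_two {n k M : ℕ} (hkn : k ≤ n) (h : n ≤ k + 5)
    (hM : IsMaxOver n k crCircular M) : M ≤ (n - k).choose 2 := by
  obtain ⟨π, rfl, rfl⟩ := hM.1
  obtain ⟨q, hq0, hq, -, hle⟩ := exists_two_mul_crCircular_le π
  have h3 := two_mul_choose_two (n - π.parts.card)
  rw [Nat.cast_sub hkn] at h3
  have : q ≤ 2 := by omega
  zify
  nlinarith

theorem circular_max_of_le_three_mul {n k M : ℕ} (hkn : k ≤ n) (h3 : n ≤ 3 * k)
    (h : 2 * k < n ∨ k + 6 ≤ n) (hM : IsMaxOver n k crCircular M) :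
    M = 6 * ((n - k) / 2).choose 2 +
      2 * ((n - k) / 2) * (if (n - k) % 2 = 1 then 1 else 0) := by
  have ht := two_mul_choose_two ((n - k) / 2)
  have hx : (if (n - k) % 2 = 1 then 1 else 0 : ℕ) = (n - k) % 2 := by
    rcases Nat.mod_two_eq_zero_or_one (n - k) with h | h <;> simp [h]
  rw [hx]
  have ha : (n : ℤ) - k = 2 * ((n - k) / 2 : ℕ) + ((n - k) % 2 : ℕ) := by omega
  have hχ := Nat.mod_two_eq_zero_or_one (n - k)
  have hpos : 1 ≤ n - k := by omega
  apply le_antisymm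
  · obtain ⟨π, rfl, rfl⟩ := hM.1
    obtain ⟨q, hq0, hq, hq1, hle⟩ := exists_two_mul_crCircular_le π
    rw [ha] at hle
    have hqt : q ≤ ((n - π.parts.card) / 2 : ℕ) := by omega
    have hq2 : 1 ≤ q ∨ 2 ≤ (((n - π.parts.card) / 2 : ℕ) : ℤ) := by
      rcases h with h | h
      · exact Or.inl (hq1 h)
      · right; omega
    generalize (((n - π.parts.card) / 2 : ℕ)) = t at *
    -- The difference of the two sides is `(t - q)(t + q - 2)`.
    have hqq : q * (q - 2) ≤ t * ((t : ℤ) - 2) := by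
      rcases eq_or_lt_of_le hqt with h | h
      · rw [h]
      · have : (0 : ℤ) ≤ q + t - 2 := by omega
        nlinarith [mul_nonneg (sub_nonneg.2 hqt) this]
    rcases hχ with hχ | hχ <;> rw [hχ] at hle ⊢ <;> zify <;> push_cast at * <;> nlinarith
  · generalize htt : (n - k) / 2 = t at *
    -- For even `n - k` the extremal partition has `t` triples; for odd `n - k` it has `t` triples
    -- and one pair, all other blocks being singletons.
    rcases hχ with hχ | hχ
    · have h1 := exists_residuePartition_le hM (by omega : 1 ≤ t) (by omega) hkn
      have h2 := crCircular_residuePartition_ge (n := n) (m := t) (q := 3) (r := 0) (by omega)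
        le_rfl (by omega) (by omega)
      rw [show n - k + t = 3 * t + 0 by omega] at h1
      rw [hχ]
      zify at h1 ⊢
      push_cast at *
      nlinarith
    · have h1 := exists_residuePartition_le hM (by omega : 1 ≤ t + 1) (by omega) hkn
      have h2 := crCircular_residuePartition_three_mul_sub_one_ge (n := n) (m := t) (by omega)
      rw [show n - k + (t + 1) = 3 * t + 2 by omega] at h1
      rw [hχ]
      zify at h1 ⊢
      push_cast at *
      nlinarith

end SetPartition

theorem theorem7 (n k : ℕ) (hk : 1 ≤ k) (hkn : k ≤ n) :
    ∃ Ml Mc : ℕ,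
      SetPartition.IsMaxOver n k SetPartition.crLinear Ml ∧
      SetPartition.IsMaxOver n k SetPartition.crCircular Mc ∧
      -- the linear parameter
      (k ≤ n / 2 → (Ml : ℤ) = ((k : ℤ) - 1) * n - 3 * (k.choose 2 : ℤ)) ∧
      ((n + 1) / 2 ≤ k → Ml = (n - k).choose 2) ∧
      -- the circular parameter
      ((k : ℚ) ≤ (n : ℚ) / 3 →
        Mc = 2 * k.choose 2 * (n / k) + 2 * (n % k).choose 2 ∧
        (Mc : ℤ) = ((k : ℤ) - 1) * n - ((n % k : ℕ) : ℤ) * ((k : ℤ) - ((n % k : ℕ) : ℤ))) ∧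
      (((n : ℚ) / 3 ≤ k ∧ (k : ℚ) < (n : ℚ) / 2) ∨ ((n : ℚ) / 2 ≤ k ∧ k + 6 ≤ n) →
        Mc = 6 * ((n - k) / 2).choose 2 +
          2 * ((n - k) / 2) * (if (n - k) % 2 = 1 then 1 else 0)) ∧
      (n ≤ k + 5 ∧ (n : ℚ) / 2 ≤ k → Mc = (n - k).choose 2) := by
  obtain ⟨Ml, hMl⟩ := SetPartition.exists_isMaxOver hk hkn SetPartition.crLinear
  obtain ⟨Mc, hMc⟩ := SetPartition.exists_isMaxOver hk hkn SetPartition.crCircular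
  have three : (k : ℚ) ≤ (n : ℚ) / 3 ↔ 3 * k ≤ n := by
    rw [le_div_iff₀ (by norm_num)]; norm_cast; rw [mul_comm]
  have three' : (n : ℚ) / 3 ≤ k ↔ n ≤ 3 * k := by
    rw [div_le_iff₀ (by norm_num)]; norm_cast; rw [mul_comm]
  have two : (k : ℚ) < (n : ℚ) / 2 ↔ 2 * k < n := by
    rw [lt_div_iff₀ (by norm_num)]; norm_cast; rw [mul_comm]
  have two' : (n : ℚ) / 2 ≤ k ↔ n ≤ 2 * k := by
    rw [div_le_iff₀ (by norm_num)]; norm_cast; rw [mul_comm]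
  rw [three, three', two, two']
  refine ⟨Ml, Mc, hMl, hMc, fun h => ?_, fun h => ?_, fun h => ?_, fun h => ?_, fun h => ?_⟩
  · exact SetPartition.linear_max_of_two_mul_le hk (by omega) hMl
  · exact SetPartition.linear_max_of_le_two_mul hkn (by omega) hMl
  · have := SetPartition.circular_max_of_three_mul_le hk h hMc
    exact ⟨SetPartition.mod_form_eq Mc this, this⟩
  · exact SetPartition.circular_max_of_le_three_mul hkn (by omega) (by omega) hMc
  · exact le_antisymm (SetPartition.circular_max_le_choose_two hkn h.1 hMc)
      (SetPartition.choose_two_le_of_le_two_mul SetPartition.crLinear_le_crCircular hkn h.2 hMc)
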